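/- Let $\Lambda$ be an artin algebra (a ring that is an algebra over a commutative artinian ring $k$ and finitely generated as a $k$-module), and let $\operatorname{mod}\Lambda$ be the abelian category of finitely generated right $\Lambda$-modules. For $M\in\operatorname{mod}\Lambda$ put $\Omega^{0}(M)=M$ and let $\Omega^{n+1}(M)$ be the kernel of a projective cover of $\Omega^{n}(M)$; for $V\in\operatorname{mod}\Lambda$ let $\operatorname{add}V$ be the class of direct summands of finite direct sums of copies of $V$. For integers $m,n\ge 0$, the algebra $\Lambda$ is called $(m,n)$-Igusa-Todorov if there is $V\in\operatorname{mod}\Lambda$ such that for every $M\in\operatorname{mod}\Lambda$ there is an exact sequence $$0\to V_m\to V_{m-1}\to\cdots\to V_1\to V_0\to\Omega^{n}(M)\to 0,\qquad V_i\in\operatorname{add}V\ (0\le i\le m).$$ The Igusa-Todorov dimension of $\Lambda$ is $$\operatorname{ITdim}\Lambda=\inf\{m\ge 0 \mid \Lambda\text{ is }(m,n)\text{-Igusa-Todorov for some } n\ge 0\}.$$ For a triangulated category $\mathcal T$ and an object $M$ of $\mathcal T$, let $\langle M\rangle_{1}$ be the full subcategory of all direct summands of finite direct sums of shifts of $M$,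 and for $d\ge 1$ let $\langle M\rangle_{d+1}$ be the full subcategory of all direct summands of objects $X$ that occur in a distinguished triangle $Y\to X\to Z\to Y[1]$ with $Y\in\langle M\rangle_{d}$ and $Z\in\langle M\rangle_{1}$. The Rouquier dimension $\dim\mathcal T$ is the least $d\ge 0$ such that $\mathcal T=\langle M\rangle_{d+1}$ for some object $M$, and $\infty$ if there is no such $d$. Then the singularity category $D_{sg}(\operatorname{mod}\Lambda)=D^{b}(\operatorname{mod}\Lambda)/K^{b}(\operatorname{proj}\Lambda)$, the Verdier quotient of the bounded derived category by the bounded homotopy category of finitely generated projective modules, satisfies $$\dim D_{sg}(\operatorname{mod}\Lambda)\le\operatorname{ITdim}\Lambda .$$ -/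

import Mathlib

open CategoryTheory Limits Pretriangulated
open scoped ZeroObject

universe w v u

noncomputable section

/-! ### Artin algebras and their module categories -/

/-- A ring `Λ` is an artin algebra if it is an algebra over some commutative artinian ring `k`
and is finitely generated as a `k`-module. (Replacing `k` by its image in `Λ`, one may always take
`k` in the universe of `Λ`.) -/
class IsArtinAlgebra (Λ : Type u) [Ring Λ] : Prop where
  exists_artinian : ∃ (k : Type u) (_ : CommRing k) (_ : Algebra k Λ),
    IsArtinianRing k ∧ Module.Finite k Λ

/-- An artin algebra is right noetherian; hence its finitely generated right modules form an
abelian category. -/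
instance IsArtinAlgebra.isNoetherianRing_op (Λ : Type u) [Ring Λ] [h : IsArtinAlgebra Λ] :
    IsNoetherianRing Λᵐᵒᵖ := by
  obtain ⟨k, _, _, _, _⟩ := h.exists_artinian
  have : IsNoetherian k Λᵐᵒᵖ :=
    isNoetherian_of_linearEquiv (MulOpposite.opLinearEquiv k : Λ ≃ₗ[k] Λᵐᵒᵖ)
  exact isNoetherian_of_tower k this

/-- `mod Λ`: the category of finitely generated right `Λ`-modules. -/
abbrev RightModFG (Λ : Type u) [Ring Λ] : Type (u + 1) := FGModuleCat.{u} Λᵐᵒᵖ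

/-! ### Syzygies and the Igusa-Todorov dimension -/

section Abelian

variable {C : Type u} [Category.{v} C] [Abelian C]

/-- A projective cover of `M`: an epimorphism `p : P ⟶ M` with `P` projective such that a
morphism `f` into `P` is an epimorphism as soon as `f ≫ p` is (that is, the kernel of `p` is
superfluous). -/
structure IsProjectiveCover {P M : C} (p : P ⟶ M) : Prop where
  projective : Projective P
  epi : Epi p
  essential : ∀ ⦃X : C⦄ (f : X ⟶ P), Epi (f ≫ p) → Epi f

/-- `N` is the syzygy `Ω(M)`: the kernel of a projective cover of `M`. -/
def IsSyzygy (M N : C) : Prop :=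
  ∃ (P : C) (p : P ⟶ M), IsProjectiveCover p ∧ Nonempty (N ≅ kernel p)

/-- `N` is the `n`-th syzygy `Ωⁿ(M)`: `Ω⁰(M) = M` and `Ωⁿ⁺¹(M) = Ω(Ωⁿ(M))`, up to isomorphism. -/
def IsNthSyzygy : ℕ → C → C → Prop
  | 0, M, N => Nonempty (N ≅ M)
  | n + 1, M, N => ∃ L : C, IsNthSyzygy n M L ∧ IsSyzygy L N

/-- `X ∈ add V`: `X` is a direct summand of a finite direct sum of copies of `V`. -/
def IsInAdd (V X : C) : Prop :=
  haveI : HasFiniteBiproducts C := Abelian.hasFiniteBiproducts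
  ∃ n : ℕ, Nonempty (Retract X (⨁ fun _ : Fin n => V))

/-- There is an exact sequence `0 ⟶ W m ⟶ ⋯ ⟶ W 1 ⟶ W 0 ⟶ N ⟶ 0` with all `W i` in `add V`
(the sequence is continued to the left by zero objects). -/
def HasAddResolution (V N : C) (m : ℕ) : Prop :=
  ∃ (W : ℕ → C) (d : ∀ i, W (i + 1) ⟶ W i) (ε : W 0 ⟶ N)
    (hd : ∀ i, d (i + 1) ≫ d i = 0) (hε : d 0 ≫ ε = 0),
    Epi ε ∧ (ShortComplex.mk (d 0) ε hε).Exact ∧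
      (∀ i, (ShortComplex.mk (d (i + 1)) (d i) (hd i)).Exact) ∧
      (∀ i, i ≤ m → IsInAdd V (W i)) ∧ (∀ i, m < i → IsZero (W i))

variable (C)

/-- The `(m, n)`-Igusa-Todorov condition on a module category `C`: there is an object `V` such
that for every `M` there is an exact sequence `0 ⟶ V_m ⟶ ⋯ ⟶ V_0 ⟶ Ωⁿ(M) ⟶ 0` with all `V_i` in
`add V`. -/
def IsIgusaTodorov (m n : ℕ) : Prop :=
  ∃ V : C, ∀ M : C, ∃ N : C, IsNthSyzygy n M N ∧ HasAddResolution V N m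

/-- The infimum of all `m` such that, for some `n`, the `(m, n)`-Igusa-Todorov condition holds
(and `⊤` if there is none). -/
def igusaTodorovDim : ℕ∞ :=
  ⨅ (m : ℕ) (_ : ∃ n : ℕ, IsIgusaTodorov C m n), (m : ℕ∞)

end Abelian

/-- The Igusa-Todorov dimension of an artin algebra `Λ`. -/
def ITdim (Λ : Type u) [Ring Λ] [IsArtinAlgebra Λ] : ℕ∞ :=
  igusaTodorovDim (RightModFG Λ)

/-! ### The Rouquier dimension of a triangulated category -/

/-- The Rouquier dimension of a triangulated category `T`: the least `d` such that
`T = ⟨M⟩_{d+1}` for some object `M` (and `⊤` if there is none). Here `⟨M⟩_{d+1}` is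
`(ObjectProperty.singleton M).triangEnvelopeIter d`: all objects which are obtained from `M` by
shifts, finite direct sums, direct summands and at most `d` extensions. -/
def rouquierDim (T : Type*) [Category* T] [HasZeroObject T] [HasShift T ℤ] [Preadditive T]
    [∀ n : ℤ, (shiftFunctor T n).Additive] [Pretriangulated T] : ℕ∞ :=
  ⨅ (d : ℕ) (_ : ∃ M : T, ∀ X : T, (ObjectProperty.singleton M).triangEnvelopeIter d X), (d : ℕ∞)

/-! ### The singularity category -/

section Singularity

variable (C : Type u) [Category.{v} C] [Abelian C]

/-- Bounded cochain complexes with projective components. -/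
def IsBoundedProjective (K : CochainComplex C ℤ) : Prop :=
  (∃ a : ℤ, K.IsStrictlyGE a) ∧ (∃ b : ℤ, K.IsStrictlyLE b) ∧ ∀ i : ℤ, Projective (K.X i)

variable [HasDerivedCategory.{w} C]

/-- `K^b(proj C)` as a full subcategory of the derived category: all objects which are isomorphic
to bounded complexes of projective objects. -/
def perfectObjects : ObjectProperty (DerivedCategory C) :=
  fun X => ∃ K : CochainComplex C ℤ, IsBoundedProjective C K ∧ Nonempty (X ≅ DerivedCategory.Q.obj K)

instance : (perfectObjects C).IsClosedUnderIsomorphisms where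
  of_iso e := by
    rintro ⟨K, hK, ⟨e'⟩⟩
    exact ⟨K, hK, ⟨e.symm ≪≫ e'⟩⟩

instance : (perfectObjects C).ContainsZero where
  exists_zero := by
    refine ⟨DerivedCategory.Q.obj 0, Functor.map_isZero _ (isZero_zero _), 0,
      ⟨⟨0, inferInstance⟩, ⟨0, inferInstance⟩, fun i => ?_⟩, ⟨Iso.refl _⟩⟩
    have : IsZero ((0 : CochainComplex C ℤ).X i) :=
      (HomologicalComplex.eval C (ComplexShape.up ℤ) i).map_isZero (isZero_zero _)
    exact this.projective

instance : (perfectObjects C).IsStableUnderShift ℤ where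
  isStableUnderShiftBy n :=
    { le_shift := by
        rintro X ⟨K, ⟨⟨a, _⟩, ⟨b, _⟩, hK⟩, ⟨e⟩⟩
        exact ⟨K⟦n⟧, ⟨⟨a - n, K.isStrictlyGE_shift a n (a - n) (by lia)⟩,
          ⟨b - n, K.isStrictlyLE_shift b n (b - n) (by lia)⟩, fun i => hK (i + n)⟩,
          ⟨(shiftFunctor (DerivedCategory C) n).mapIso e ≪≫
            ((DerivedCategory.Q (C := C)).commShiftIso n).symm.app K⟩⟩ }

instance : (perfectObjects C).IsTriangulatedClosed₃ where
  ext₃' T hT := by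
    rintro ⟨K, ⟨⟨a, _⟩, ⟨b, _⟩, hK⟩, ⟨e₁⟩⟩ ⟨L, ⟨⟨a', _⟩, ⟨b', _⟩, hL⟩, ⟨e₂⟩⟩
    have := K.isKProjective_of_projective b
    obtain ⟨f, hf⟩ : ∃ f : K ⟶ L,
        DerivedCategory.Q.map f = e₁.inv ≫ T.mor₁ ≫ e₂.hom := by
      obtain ⟨g, hg⟩ := (CochainComplex.IsKProjective.Qh_map_bijective K
        ((HomotopyCategory.quotient _ _).obj L)).surjective
        ((DerivedCategory.quotientCompQhIso C).hom.app K ≫ (e₁.inv ≫ T.mor₁ ≫ e₂.hom) ≫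
          (DerivedCategory.quotientCompQhIso C).inv.app L)
      obtain ⟨f, rfl⟩ := (HomotopyCategory.quotient _ _).map_surjective g
      refine ⟨f, ?_⟩
      rw [← cancel_epi ((DerivedCategory.quotientCompQhIso C).hom.app K),
        ← DerivedCategory.quotientCompQhIso_hom_naturality, hg]
      simp
    refine ObjectProperty.le_isoClosure _ _ ⟨CochainComplex.mappingCone f,
      ⟨⟨min (a - 1) a', CochainComplex.isStrictlyGE_mappingCone f a a' _
        (by simp) (by simp)⟩, ⟨max b b', ?_⟩, fun i => ?_⟩, ⟨?_⟩⟩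
    · rw [CochainComplex.isStrictlyLE_iff]
      intro i hi
      rw [CochainComplex.mappingCone.isZero_X_iff]
      exact ⟨K.isZero_of_isStrictlyLE b _ (by have := le_max_left b b'; lia),
        L.isZero_of_isStrictlyLE b' _ (by have := le_max_right b b'; lia)⟩
    · have := hK (i + 1)
      have := hL i
      exact Projective.of_iso
        (HomologicalComplex.homotopyCofiber.XIsoBiprod f i (i + 1) rfl).symm inferInstance
    · exact Triangle.π₃.mapIso (isoTriangleOfIso₁₂ T _ hT
        (DerivedCategory.mappingCone_triangle_distinguished f) e₁ e₂ (by
          have h : T.mor₁ ≫ e₂.hom = e₁.hom ≫ DerivedCategory.Q.map f := by simp [hf]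
          exact h))

instance : (perfectObjects C).IsTriangulated where
  toIsTriangulatedClosed₂ := .of_isTriangulatedClosed₃

/-- `K^b(proj C)` as a triangulated subcategory of the bounded derived category `D^b(C)`. -/
abbrev boundedPerfectObjects : ObjectProperty (DerivedCategory.Bounded C) :=
  (perfectObjects C).inverseImage DerivedCategory.Bounded.ι

/-- The singularity category `D^b(C) / K^b(proj C)`: the Verdier quotient, that is, the
localization of `D^b(C)` at the morphisms whose cone lies in `K^b(proj C)`. -/
abbrev SingularityCategory : Type (max u v) :=
  (boundedPerfectObjects C).trW.Localization

end Singularity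

end

/-! ### Enough projectives in the category of finitely generated modules -/

/-! Perfect complexes become zero in the singularity category, and this has two consequences. First,
the sequence `0 → ΩM → P → M → 0` gives a triangle whose middle term vanishes, so `M ≅ (ΩM)[1]`
(`nonempty_iso_shift_of_isSyzygy`). Second, the top cohomology of a bounded complex can be killed by
the stalk complex of a projective without changing the object up to isomorphism. Iterating shortens
the complex to a single degree, so up to isomorphism every object is a shift of a module
(`prop_of_prop_single`, resting on `DerivedCategory.bounded_induction`).

Every object is therefore a shift of some `Ωⁿ M`. A resolution of `Ωⁿ M` of length `m` by objects of
`add V` splits into `m` short exact sequences. Each becomes a triangle and costs one extension,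
which puts `Ωⁿ M` in `⟨V⟩_{m+1}` (`HasAddResolution.triangEnvelopeIter`). Thus `V` itself generates
in `m` extensions. The only property of `mod Λ` needed beyond being abelian is that it has enough
projectives. -/

theorem FGModuleCat.epi_iff_surjective {R : Type u} [Ring R] [IsNoetherianRing R]
    {M N : FGModuleCat.{u} R} (f : M ⟶ N) : Epi f ↔ Function.Surjective f.hom.hom := by
  rw [← ModuleCat.epi_iff_surjective]
  refine ⟨fun _ => ?_, fun h => ?_⟩
  · exact inferInstanceAs (Epi ((forget₂ (FGModuleCat R) (ModuleCat.{u} R)).map f))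
  · exact (forget₂ (FGModuleCat R) (ModuleCat.{u} R)).epi_of_epi_map h

theorem FGModuleCat.projective_of_module_projective {R : Type u} [Ring R] [IsNoetherianRing R]
    (P : FGModuleCat.{u} R) [Module.Projective R P] : Projective P where
  factors {E X} f e _ := by
    obtain ⟨g, hg⟩ := Module.projective_lifting_property e.hom.hom f.hom.hom
      ((FGModuleCat.epi_iff_surjective e).mp inferInstance)
    exact ⟨ObjectProperty.homMk (ModuleCat.ofHom g), FGModuleCat.hom_ext hg⟩

instance FGModuleCat.enoughProjectives (R : Type u) [Ring R] [IsNoetherianRing R] :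
    EnoughProjectives (FGModuleCat.{u} R) where
  presentation M := by
    obtain ⟨n, f, hf⟩ := Module.Finite.exists_fin' R M
    let g : FGModuleCat.of R (Fin n → R) ⟶ M := ObjectProperty.homMk (ModuleCat.ofHom f)
    have : Module.Projective R (FGModuleCat.of R (Fin n → R)) :=
      inferInstanceAs (Module.Projective R (Fin n → R))
    exact ⟨{ p := _
             projective := FGModuleCat.projective_of_module_projective _
             f := g
             epi := (FGModuleCat.epi_iff_surjective g).mpr hf }⟩

/-! ### Objects of the Rouquier filtration -/

namespace CategoryTheory.ObjectProperty

/-- A triangle in the ambient category on objects of a triangulated subcategory lifts to a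
distinguished triangle of the subcategory. -/
theorem exists_distTriang_fullSubcategory {T : Type*} [Category* T] [HasZeroObject T]
    [HasShift T ℤ] [Preadditive T] [∀ n : ℤ, (shiftFunctor T n).Additive] [Pretriangulated T]
    (P : ObjectProperty T) [P.IsTriangulated] {X Y Z : P.FullSubcategory}
    {f : X.obj ⟶ Y.obj} {g : Y.obj ⟶ Z.obj} {h : Z.obj ⟶ X.obj⟦(1 : ℤ)⟧}
    (H : Triangle.mk f g h ∈ distTriang T) :
    ∃ (h' : Z ⟶ X⟦(1 : ℤ)⟧),
      Triangle.mk (homMk f) (homMk g) h' ∈ distTriang P.FullSubcategory := by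
  -- The shift of the subcategory agrees with the ambient one only through `commShiftIso`, so the
  -- connecting morphism is corrected by it.
  refine ⟨P.fullyFaithfulι.preimage (h ≫ (P.ι.commShiftIso (1 : ℤ)).inv.app X), ?_⟩
  refine isomorphic_distinguished _ H _
    (Triangle.isoMk _ _ (Iso.refl _) (Iso.refl _) (Iso.refl _) ?_ ?_ ?_)
  · exact (Category.comp_id _).trans (Category.id_comp _).symm
  · exact (Category.comp_id _).trans (Category.id_comp _).symm
  · change ((h ≫ (P.ι.commShiftIso (1 : ℤ)).inv.app X) ≫ (P.ι.commShiftIso (1 : ℤ)).hom.app X) ≫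
      (𝟙 X.obj)⟦(1 : ℤ)⟧' = 𝟙 Z.obj ≫ h
    rw [Category.assoc, Category.assoc, Iso.inv_hom_id_app_assoc, Category.id_comp]
    exact (congrArg (h ≫ ·) ((shiftFunctor T (1 : ℤ)).map_id X.obj)).trans (Category.comp_id h)

variable {T : Type*} [Category* T] [HasZeroObject T] [HasShift T ℤ] [Preadditive T]
  [∀ n : ℤ, (shiftFunctor T n).Additive] [Pretriangulated T]

/-- The retract closure of a class of objects closed under binary products is again closed under
binary products. -/
instance isClosedUnderBinaryProducts_retractClosure {T : Type*} [Category* T]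
    [HasBinaryProducts T] (P : ObjectProperty T) [P.IsClosedUnderBinaryProducts] :
    P.retractClosure.IsClosedUnderBinaryProducts where
  limitsOfShape_le := by
    rintro X ⟨p⟩
    obtain ⟨Y₁, h₁, ⟨r₁⟩⟩ := p.prop_diag_obj (.mk .left)
    obtain ⟨Y₂, h₂, ⟨r₂⟩⟩ := p.prop_diag_obj (.mk .right)
    refine P.retractClosure.prop_of_iso
      (IsLimit.conePointUniqueUpToIso (prodIsProd _ _)
        ((IsLimit.postcomposeHomEquiv (diagramIsoPair p.diag) _).2 p.isLimit)) ?_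
    exact ⟨Y₁ ⨯ Y₂, P.prop_prod _ _ h₁ h₂,
      ⟨{ i := Limits.prod.map r₁.i r₂.i
         r := Limits.prod.map r₁.r r₂.r }⟩⟩

instance (P : ObjectProperty T) [P.Nonempty] : P.retractClosure.ContainsZero where
  exists_zero := by
    refine ⟨0, isZero_zero T, P.arbitrary, P.prop_arbitrary, ⟨{ i := 0, r := 0 }⟩⟩

/-- Binary products pass to the retract closure, and zero is a retract of any object; together these
give all finite products. -/
instance (P : ObjectProperty T) [P.Nonempty] :
    (P.triangEnvelopeIter 0).IsClosedUnderFiniteProducts := by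
  rw [triangEnvelopeIter_zero]
  exact .mk'

end CategoryTheory.ObjectProperty

/-- An additive functor preserves finite direct sums and retracts, so it carries `add V` into `⟨S
V⟩₁`. -/
theorem IsInAdd.triangEnvelopeIter_zero {C : Type u} [Category.{v} C] [Abelian C]
    {T : Type*} [Category* T] [HasZeroObject T] [HasShift T ℤ] [Preadditive T]
    [∀ n : ℤ, (shiftFunctor T n).Additive] [Pretriangulated T]
    (S : C ⥤ T) [S.Additive] {V X : C} (h : IsInAdd V X) :
    (ObjectProperty.singleton (S.obj V)).triangEnvelopeIter 0 (S.obj X) := by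
  have : HasFiniteBiproducts C := Abelian.hasFiniteBiproducts
  obtain ⟨n, ⟨r⟩⟩ := h
  refine ObjectProperty.prop_of_retract _ (r.map S) ?_
  have := HasFiniteBiproducts.of_hasFiniteProducts (C := T)
  refine ObjectProperty.prop_of_iso _
    (S.mapBiproduct (fun _ : Fin n => V) ≪≫ biproduct.isoProduct _).symm ?_
  refine ObjectProperty.prop_product _ (fun i => ?_)
  exact ObjectProperty.le_triangEnvelopeIter _ _ _ (by simp)

/-! ### Resolutions by objects of `add V` -/

/-- Cutting off the first term of an `add V`-resolution gives a short exact sequence and a shorter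
resolution of the kernel. -/
theorem HasAddResolution.exists_shortExact {C : Type u} [Category.{v} C] [Abelian C] {V N : C}
    {m : ℕ} (h : HasAddResolution V N (m + 1)) :
    ∃ S : ShortComplex C, S.ShortExact ∧ IsInAdd V S.X₂ ∧ Nonempty (S.X₃ ≅ N) ∧
      HasAddResolution V S.X₁ m := by
  obtain ⟨W, d, ε, hd, hε, hepi, hex, hexd, hW, hW0⟩ := h
  have hS : (ShortComplex.mk (kernel.ι ε) ε (kernel.condition ε)).ShortExact :=
    { exact := ShortComplex.exact_of_f_is_kernel _ (kernelIsKernel ε)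
      mono_f := inferInstance
      epi_g := hepi }
  refine ⟨_, hS, hW 0 (by lia), ⟨Iso.refl _⟩, fun i => W (i + 1), fun i => d (i + 1),
    kernel.lift ε (d 0) hε, fun i => hd (i + 1), ?_, ?_, ?_, fun i => hexd (i + 1),
    fun i hi => hW _ (by lia), fun i hi => hW0 _ (by lia)⟩
  · rw [← cancel_mono (kernel.ι ε)]
    simp [hd]
  · exact hex.epi_kernelLift
  · refine (ShortComplex.exact_iff_of_epi_of_isIso_of_mono
      (S₁ := ShortComplex.mk (d 1) (kernel.lift ε (d 0) hε) _)
      (S₂ := ShortComplex.mk (d 1) (d 0) (hd 0))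
      { τ₁ := 𝟙 _, τ₂ := 𝟙 _, τ₃ := kernel.ι ε }).mpr (hexd 0)

/-- An object with an `add V`-resolution of length `0` is in `add V`. -/
theorem HasAddResolution.isInAdd {C : Type u} [Category.{v} C] [Abelian C] {V N : C}
    (h : HasAddResolution V N 0) : IsInAdd V N := by
  obtain ⟨W, d, ε, hd, hε, hepi, hex, hexd, hW, hW0⟩ := h
  -- Since `W 1` is zero, exactness at `W 0` makes `ε` a monomorphism.
  have : Mono ε := hex.mono_g ((hW0 1 (by lia)).eq_of_src _ _)
  have : IsIso ε := isIso_of_mono_of_epi ε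
  obtain ⟨n, ⟨r⟩⟩ := hW 0 le_rfl
  exact ⟨n, ⟨(Retract.ofIso (asIso ε).symm).trans r⟩⟩

/-- If a functor `S` to a triangulated category sends short exact sequences to distinguished
triangles, objects with an `add V`-resolution of length `m` lie in `⟨S V⟩_{m+1}`. -/
theorem HasAddResolution.triangEnvelopeIter {C : Type u} [Category.{v} C] [Abelian C]
    {T : Type*} [Category* T] [HasZeroObject T] [HasShift T ℤ] [Preadditive T]
    [∀ n : ℤ, (shiftFunctor T n).Additive] [Pretriangulated T]
    (S : C ⥤ T) [S.Additive]
    (hS : ∀ E : ShortComplex C, E.ShortExact →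
      ∃ δ, Triangle.mk (S.map E.f) (S.map E.g) δ ∈ distTriang T)
    {V : C} (m : ℕ) {N : C} (h : HasAddResolution V N m) :
    (ObjectProperty.singleton (S.obj V)).triangEnvelopeIter m (S.obj N) := by
  induction m generalizing N with
  | zero => exact h.isInAdd.triangEnvelopeIter_zero S
  | succ m ih =>
    obtain ⟨E, hE, hE₂, ⟨e⟩, hE₁⟩ := h.exists_shortExact
    obtain ⟨δ, hδ⟩ := hS E hE
    refine ObjectProperty.prop_of_iso _ (S.mapIso e) ?_
    rw [ObjectProperty.triangEnvelopeIter_succ, ← ObjectProperty.triangEnvelopeIter_zero]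
    -- After rotation `E.X₃` is the middle term of `E.X₂ → E.X₃ → E.X₁[1]`, with outer terms in
    -- levels `0` and `m`.
    exact ObjectProperty.le_retractClosure _ _ ⟨_, _, _, _, _, rot_of_distTriang _ hδ,
      hE₂.triangEnvelopeIter_zero S, ObjectProperty.le_shift _ (1 : ℤ) _ (ih hE₁)⟩

/-! ### Objects of the bounded derived category up to perfect complexes -/

/-- A morphism of complexes which is epi in degree `i` is epi on homology in degree `i` if the
target has zero differential in degree `i` and so has the source. -/
theorem HomologicalComplex.epi_homologyMap_of_epi {C : Type u} [Category.{v} C] [Abelian C]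
    {ι : Type*} {c : ComplexShape ι} {K L : HomologicalComplex C c} (f : K ⟶ L) (i : ι) [Epi (f.f i)]
    (hK : K.d i (c.next i) = 0) (hL : L.d i (c.next i) = 0) :
    Epi (HomologicalComplex.homologyMap f i) := by
  have := K.isIso_iCycles i _ rfl hK
  have := L.isIso_iCycles i _ rfl hL
  have : Epi (HomologicalComplex.cyclesMap f i) := by
    have : HomologicalComplex.cyclesMap f i = K.iCycles i ≫ f.f i ≫ inv (L.iCycles i) := by
      rw [← cancel_mono (L.iCycles i)]
      simp
    rw [this]
    infer_instance
  have : Epi (K.homologyπ i ≫ HomologicalComplex.homologyMap f i) := by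
    rw [HomologicalComplex.homologyπ_naturality]
    infer_instance
  exact epi_of_epi (K.homologyπ i) _

namespace DerivedCategory

variable {C : Type u} [Category.{v} C] [Abelian C] [HasDerivedCategory.{w} C]

theorem bounded_of_isGE_of_isLE (X : DerivedCategory C) (a b : ℤ) [X.IsGE a] [X.IsLE b] :
    (TStructure.t (C := C)).bounded X :=
  ⟨⟨a, inferInstance⟩, ⟨b, inferInstance⟩⟩

theorem perfectObjects_singleFunctor_obj {P : C} (hP : Projective P) (n : ℤ) :
    perfectObjects C ((singleFunctor C n).obj P) := by
  refine ⟨(CochainComplex.singleFunctor C n).obj P, ⟨⟨n, inferInstance⟩, ⟨n, inferInstance⟩, ?_⟩,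
    ⟨(singleFunctorIsoCompQ C n).app P⟩⟩
  intro i
  by_cases hi : i = n
  · subst hi
    exact Projective.of_iso (HomologicalComplex.singleObjXSelf (.up ℤ) i P).symm hP
  · exact (HomologicalComplex.isZero_single_obj_X (.up ℤ) n P i hi).projective

/-- If `C` has enough projectives, the top cohomology of a bounded object can be killed by a
shifted projective object. -/
theorem exists_distTriang_single_projective [EnoughProjectives C] (X : DerivedCategory C)
    (a b : ℤ) (hab : a ≤ b) [X.IsGE a] [X.IsLE (b + 1)] :
    ∃ (P : C) (_ : Projective P) (Z : DerivedCategory C) (_ : Z.IsGE a) (_ : Z.IsLE b)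
      (f : (singleFunctor C (b + 1)).obj P ⟶ X) (g : X ⟶ Z)
      (h : Z ⟶ ((singleFunctor C (b + 1)).obj P)⟦(1 : ℤ)⟧),
      Triangle.mk f g h ∈ distTriang (DerivedCategory C) := by
  obtain ⟨K, _, _, ⟨e⟩⟩ := exists_iso_Q_obj_of_isGE_of_isLE X a (b + 1)
  -- Degree `b + 1` is the top of `K`, so any morphism into `K.X (b + 1)` defines a chain map from a
  -- stalk complex.
  have hKd : ∀ j, K.d (b + 1) j = 0 := fun j => by
    by_cases hj : b + 1 + 1 = j
    · exact (K.isZero_of_isStrictlyLE (b + 1) j (by lia)).eq_of_tgt _ _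
    · exact K.shape _ _ hj
  let P := Projective.over (K.X (b + 1))
  let φ : (HomologicalComplex.single C (.up ℤ) (b + 1)).obj P ⟶ K :=
    HomologicalComplex.mkHomFromSingle (Projective.π (K.X (b + 1))) (fun j _ => by simp [hKd])
  have hφ : Epi (φ.f (b + 1)) := by
    dsimp only [φ]
    rw [HomologicalComplex.mkHomFromSingle_f]
    infer_instance
  have hφ' : Epi (HomologicalComplex.homologyMap φ (b + 1)) :=
    HomologicalComplex.epi_homologyMap_of_epi φ _ (by simp) (hKd _)
  let ψ : (singleFunctor C (b + 1)).obj P ⟶ X :=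
    (singleFunctorIsoCompQ C (b + 1)).hom.app P ≫ Q.map φ ≫ e.inv
  have hψ : Epi ((homologyFunctor C (b + 1)).map ψ) := by
    have : Epi ((homologyFunctor C (b + 1)).map (Q.map φ)) :=
      ((MorphismProperty.epimorphisms C).arrow_mk_iso_iff
        ((Functor.mapArrowFunctor _ _).mapIso (homologyFunctorFactors C (b + 1)) |>.app
          (Arrow.mk φ))).mpr hφ'
    simp only [ψ, Functor.map_comp]
    have : Epi ((homologyFunctor C (b + 1)).map (Q.map φ) ≫ (homologyFunctor C (b + 1)).map e.inv) :=
      epi_comp _ _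
    exact epi_comp' inferInstance this
  obtain ⟨Z, g, h, hT⟩ := distinguished_cocone_triangle ψ
  -- `Hⁱ(Z)` sits between `Hⁱ(X)` and `Hⁱ⁺¹` of the stalk complex in the long exact sequence.
  have key : ∀ i, IsZero ((homologyFunctor C (i + 1)).obj ((singleFunctor C (b + 1)).obj P)) →
      (homologyFunctor C i).map g = 0 → IsZero ((homologyFunctor C i).obj Z) := by
    intro i h₁ h₂
    exact (HomologySequence.exact₃ _ hT i (i + 1)).isZero_of_both_zeros h₂ (h₁.eq_of_tgt _ _)
  refine ⟨P, inferInstance, Z, ?_, ?_, ψ, g, h, hT⟩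
  · rw [isGE_iff]
    intro i hi
    -- Here `i < a ≤ b`, so `i + 1` lies strictly below the degree of the stalk complex.
    exact key i (isZero_of_isGE _ (b + 1) _ (by lia))
      ((isZero_of_isGE X a i hi).eq_of_src _ _)
  · rw [isLE_iff]
    intro i hi
    refine key i (isZero_of_isLE _ (b + 1) _ (by lia)) ?_
    -- In degree `b + 1` surjectivity of `ψ` on cohomology kills `g`; above it `X` has no
    -- cohomology.
    obtain rfl | hi' := (show b + 1 ≤ i from hi).eq_or_lt
    · exact (HomologySequence.epi_homologyMap_mor₁_iff _ hT _).mp hψ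
    · exact (isZero_of_isLE X (b + 1) i hi').eq_of_src _ _

/-- Every bounded object lies in a class `E` of bounded objects as soon as `E` contains the shifts
of the objects of `C` and is invariant under killing a shifted projective object. -/
theorem bounded_induction [EnoughProjectives C] (E : ObjectProperty (DerivedCategory C))
    [E.IsClosedUnderIsomorphisms]
    (single : ∀ (M : C) (n : ℤ), E ((singleFunctor C n).obj M))
    (cone : ∀ T ∈ distTriang (DerivedCategory C), perfectObjects C T.obj₁ →
      (TStructure.t (C := C)).bounded T.obj₁ → (TStructure.t (C := C)).bounded T.obj₂ →
      (TStructure.t (C := C)).bounded T.obj₃ → E T.obj₃ → E T.obj₂)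
    (X : DerivedCategory C) (hX : (TStructure.t (C := C)).bounded X) : E X := by
  -- Induction on the width `n` of the interval `[a, a + n]` containing the cohomology.
  suffices H : ∀ (n : ℕ) (a : ℤ) (X : DerivedCategory C), X.IsGE a → X.IsLE (a + n) → E X by
    obtain ⟨⟨a, ha⟩, ⟨b, hb⟩⟩ := hX
    refine H (b - a).toNat a X ha ?_
    exact TStructure.t.isLE_of_le X b _ (by lia)
  intro n a
  induction n with
  | zero =>
    intro X _ hX
    have : X.IsLE a := by simpa using hX
    obtain ⟨M, ⟨e⟩⟩ := exists_iso_singleFunctor_obj_of_isGE_of_isLE X a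
    exact E.prop_of_iso e.symm (single M a)
  | succ n ih =>
    intro X _ hX
    have : X.IsLE (a + n + 1) := by simpa [add_assoc] using hX
    obtain ⟨P, hP, Z, hZ, hZ', f, g, h, hT⟩ :=
      exists_distTriang_single_projective X a (a + n) (by lia)
    exact cone _ hT (perfectObjects_singleFunctor_obj hP _)
      (bounded_of_isGE_of_isLE ((singleFunctor C (a + n + 1)).obj P) (a + n + 1) (a + n + 1))
      (bounded_of_isGE_of_isLE X a (a + n + 1)) (bounded_of_isGE_of_isLE Z a (a + n)) (ih Z hZ hZ')

end DerivedCategory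

/-! ### The singularity category -/

namespace SingularityCategory

variable (C : Type u) [Category.{v} C] [Abelian C] [HasDerivedCategory.{w} C]

/-- The functor sending an object of `C` to the complex concentrated in degree `0`. -/
noncomputable abbrev boundedSingle : C ⥤ DerivedCategory.Bounded C :=
  (DerivedCategory.TStructure.t (C := C)).bounded.lift (DerivedCategory.singleFunctor C 0)
    (fun M => DerivedCategory.bounded_of_isGE_of_isLE
      ((DerivedCategory.singleFunctor C 0).obj M) 0 0)

/-- The quotient functor from the bounded derived category. -/
noncomputable abbrev quotient : DerivedCategory.Bounded C ⥤ SingularityCategory C :=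
  (boundedPerfectObjects C).trW.Q

/-- The functor from an abelian category to its singularity category. -/
noncomputable abbrev single : C ⥤ SingularityCategory C := boundedSingle C ⋙ quotient C

instance : (boundedSingle C).Additive where
  map_add := ObjectProperty.hom_ext _ (DerivedCategory.singleFunctor C 0).map_add

variable {C}

theorem exists_distTriang_boundedSingle (S : ShortComplex C) (hS : S.ShortExact) :
    ∃ δ, Triangle.mk ((boundedSingle C).map S.f) ((boundedSingle C).map S.g) δ ∈
      distTriang (DerivedCategory.Bounded C) :=
  ObjectProperty.exists_distTriang_fullSubcategory _
    (X := (boundedSingle C).obj S.X₁) (Y := (boundedSingle C).obj S.X₂)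
    (Z := (boundedSingle C).obj S.X₃) hS.singleTriangle_distinguished

theorem exists_distTriang_single (S : ShortComplex C) (hS : S.ShortExact) :
    ∃ δ, Triangle.mk ((single C).map S.f) ((single C).map S.g) δ ∈
      distTriang (SingularityCategory C) := by
  obtain ⟨δ, hδ⟩ := exists_distTriang_boundedSingle S hS
  exact ⟨_, (quotient C).map_distinguished _ hδ⟩

/-- The cone of a morphism from a perfect complex becomes isomorphic to its target. -/
theorem isIso_quotient_map_mor₂ (T : Triangle (DerivedCategory.Bounded C)) (hT : T ∈ distTriang _)
    (h : boundedPerfectObjects C T.obj₁) : IsIso ((quotient C).map T.mor₂) :=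
  Localization.inverts (quotient C) (boundedPerfectObjects C).trW _
    (((boundedPerfectObjects C).trW_iff_of_distinguished' T hT).mpr h)

/-- In the singularity category, an object is the shift of its syzygy. -/
theorem nonempty_iso_shift_of_isSyzygy {M N : C} (h : IsSyzygy M N) :
    Nonempty ((single C).obj M ≅ ((single C).obj N)⟦(1 : ℤ)⟧) := by
  obtain ⟨P, p, hp, ⟨e⟩⟩ := h
  have := hp.epi
  have hS : (ShortComplex.mk (kernel.ι p) p (kernel.condition p)).ShortExact :=
    { exact := ShortComplex.exact_of_f_is_kernel _ (kernelIsKernel p)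
      mono_f := inferInstance
      epi_g := inferInstance }
  obtain ⟨δ, hδ⟩ := exists_distTriang_boundedSingle _ hS
  -- In the rotated triangle `P → M → (ΩM)[1]` the first term is perfect and `δ` is the second
  -- morphism.
  have : IsIso ((quotient C).map δ) := isIso_quotient_map_mor₂ _ (rot_of_distTriang _ hδ)
    (DerivedCategory.perfectObjects_singleFunctor_obj hp.projective 0)
  exact ⟨asIso ((quotient C).map δ) ≪≫ ((quotient C).commShiftIso (1 : ℤ)).app _ ≪≫
    (shiftFunctor _ (1 : ℤ)).mapIso ((single C).mapIso e.symm)⟩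

/-- Passing to a syzygy is only a shift in the singularity category, so a shift-stable class cannot
tell `M` from `Ωⁿ M`. -/
theorem prop_single_of_isNthSyzygy (A : ObjectProperty (SingularityCategory C))
    [A.IsClosedUnderIsomorphisms] [A.IsStableUnderShift ℤ] (n : ℕ) {M N : C}
    (h : IsNthSyzygy n M N) (hN : A ((single C).obj N)) : A ((single C).obj M) := by
  induction n generalizing N with
  | zero => exact A.prop_of_iso ((single C).mapIso h.some) hN
  | succ n ih =>
    obtain ⟨L, hL, hLN⟩ := h
    obtain ⟨e⟩ := nonempty_iso_shift_of_isSyzygy hLN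
    exact ih hL (A.prop_of_iso e.symm (A.le_shift (1 : ℤ) _ hN))

/-- A class of objects of the singularity category which is stable under shifts and contains the
objects coming from `C` contains everything. -/
theorem prop_of_prop_single [EnoughProjectives C] (A : ObjectProperty (SingularityCategory C))
    [A.IsClosedUnderIsomorphisms] [A.IsStableUnderShift ℤ]
    (hA : ∀ M : C, A ((single C).obj M)) (X : SingularityCategory C) : A X := by
  have : (quotient C).EssSurj := Localization.essSurj _ (boundedPerfectObjects C).trW
  refine A.prop_of_iso ((quotient C).objObjPreimageIso X) ?_
  -- The induction runs in the unbounded derived category, so boundedness, needed to apply the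
  -- quotient functor, is made a hypothesis inside `E`.
  let E : ObjectProperty (DerivedCategory C) := fun Y =>
    ∀ hY : (DerivedCategory.TStructure.t (C := C)).bounded Y, A ((quotient C).obj ⟨Y, hY⟩)
  have : E.IsClosedUnderIsomorphisms :=
    { of_iso := fun {Y Z} e h hZ => by
        have hY := ObjectProperty.prop_of_iso _ e.symm hZ
        exact A.prop_of_iso ((quotient C).mapIso
          (ObjectProperty.isoMk _ (X := ⟨Y, hY⟩) (Y := ⟨Z, hZ⟩) e)) (h hY) }
  refine DerivedCategory.bounded_induction E (fun M n hM => ?_) ?_ _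
    ((quotient C).objPreimage X).property _
  · let Y := (boundedSingle C).obj M
    -- The stalk complex in degree `n` is the shift by `-n` of the one in degree `0`.
    let e : (⟨_, hM⟩ : DerivedCategory.Bounded C) ≅ Y⟦-n⟧ :=
      (DerivedCategory.Bounded.ι (C := C)).preimageIso
        (((DerivedCategory.singleFunctors C).shiftIso (-n) n 0 (by simp)).symm.app M ≪≫
          (((DerivedCategory.Bounded.ι (C := C)).commShiftIso (-n)).app Y).symm)
    exact A.prop_of_iso ((quotient C).mapIso e ≪≫ ((quotient C).commShiftIso (-n)).app Y).symm
      (A.le_shift (-n) _ (hA M))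
  · intro T hT hP h₁ h₂ h₃ h _
    obtain ⟨δ, hδ⟩ := ObjectProperty.exists_distTriang_fullSubcategory _
      (X := ⟨T.obj₁, h₁⟩) (Y := ⟨T.obj₂, h₂⟩) (Z := ⟨T.obj₃, h₃⟩) hT
    have := isIso_quotient_map_mor₂ _ hδ hP
    exact A.prop_of_iso (@asIso _ _ _ _ _ this).symm (h h₃)

/-- If `C` has enough projectives and is `(m, n)`-Igusa-Todorov, its singularity category has
Rouquier dimension at most `m`. -/
theorem rouquierDim_le_of_isIgusaTodorov [EnoughProjectives C] {m n : ℕ}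
    (h : IsIgusaTodorov C m n) : rouquierDim (SingularityCategory C) ≤ m := by
  obtain ⟨V, hV⟩ := h
  refine iInf₂_le m ⟨(single C).obj V, prop_of_prop_single _ fun M => ?_⟩
  obtain ⟨N, hN, hres⟩ := hV M
  exact prop_single_of_isNthSyzygy _ n hN
    (hres.triangEnvelopeIter (single C) exists_distTriang_single m)

theorem rouquierDim_le_igusaTodorovDim [EnoughProjectives C] :
    rouquierDim (SingularityCategory C) ≤ igusaTodorovDim C :=
  le_iInf₂ fun _ h => rouquierDim_le_of_isIgusaTodorov h.choose_spec

end SingularityCategory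

/-- For every artin algebra `Λ`, the Rouquier dimension of the singularity category
`D^b(mod Λ) / K^b(proj Λ)` is at most the Igusa-Todorov dimension of `Λ`. -/
theorem mainTheorem3 (Λ : Type u) [Ring Λ] [IsArtinAlgebra Λ]
    [HasDerivedCategory.{w} (RightModFG Λ)] :
    rouquierDim (SingularityCategory (RightModFG Λ)) ≤ ITdim Λ :=
  SingularityCategory.rouquierDim_le_igusaTodorovDim
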